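/- **Theorem (moderate deviations, sublinear regime).** Let $\lambda,\mu,\alpha>0$. On a probability space $(\Omega,\mathfrak F,\mathbf P)$ let $(\eta(k))_{k\ge 0}$ be a Markov chain on $\mathbb Z^+=\{0,1,2,\dots\}$ with $\eta(0)=0$ and transition probabilities $$\mathbf P(\eta(k+1)=j\mid \eta(k)=i)=\begin{cases}\frac{\lambda}{\lambda+\mu}, & i\ne 0,\ j=i+1,\\ \frac{\mu}{i(\lambda+\mu)}, & i\neq 0,\ 0\le j<i,\\ 1,& i=0,\ j=1,\end{cases}$$ (all other transition probabilities being $0$), and let $(\nu(t))_{t\ge0}$ be a Poisson process with rate $\alpha$ that is independent of $\eta$. Put $\xi(t)=\eta(\nu(t))$, $t\ge 0$ (the Poisson process with uniform catastrophes). Let $\varphi:[0,\infty)\to\mathbb R$ satisfy $$\lim_{T\to\infty}\frac{\varphi(T)}{T}=0\qquad\text{and}\qquad \lim_{T\to\infty}\frac{\varphi(T)}{T^{a}}=\infty\ \text{ for some } a\in(0,1),$$ and define $$I_1(x)=\begin{cases}\infty, & x<0,\\ x\ln\frac{\lambda+\mu}{\lambda}, & x\ge 0.\end{cases}$$ Then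 the family of random variables $\xi_T(1)=\xi(T)/\varphi(T)$ satisfies, as $T\to\infty$, the large deviation principle on $\mathbb R$ with normalizing function $\varphi(T)$ and rate function $I_1$. That is: $\varphi(T)\to\infty$ as $T\to\infty$; for every $c\ge 0$ the set $\{x\in\mathbb R: I_1(x)\le c\}$ is compact; and for every Borel set $B\subseteq\mathbb R$, with closure $[B]$ and interior $(B)$, $$\limsup_{T\to\infty}\frac1{\varphi(T)}\ln\mathbf P\Big(\frac{\xi(T)}{\varphi(T)}\in B\Big)\le-\inf_{x\in[B]}I_1(x),\qquad \liminf_{T\to\infty}\frac1{\varphi(T)}\ln\mathbf P\Big(\frac{\xi(T)}{\varphi(T)}\in B\Big)\ge-\inf_{x\in(B)}I_1(x),$$ where $\ln 0=-\infty$ and $\inf\emptyset=\infty$. -/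

import Mathlib

open MeasureTheory ProbabilityTheory Filter Topology
open scoped NNReal ENNReal

noncomputable section

/-- One-step transition probabilities of the embedded chain: from `i ≠ 0` the chain moves to `i + 1`
with probability `lam / (lam + mu)` and to each `j < i` with probability `mu / (i * (lam + mu))`;
from `0` it moves to `1`. -/
def transProb (lam mu : ℝ) (i j : ℕ) : ℝ :=
  if i = 0 then (if j = 1 then 1 else 0)
  else if j = i + 1 then lam / (lam + mu)
  else if j < i then mu / (i * (lam + mu))
  else 0

/-- `η` is a time-homogeneous Markov chain on `ℕ` with transition probabilities
`transProb lam mu`, started at `0`. -/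
structure IsCatastropheChain {Ω : Type*} [MeasurableSpace Ω] (P : Measure Ω)
    (lam mu : ℝ) (η : ℕ → Ω → ℕ) : Prop where
  measurable : ∀ k, Measurable (η k)
  init : ∀ᵐ ω ∂P, η 0 ω = 0
  markov : ∀ (k : ℕ) (x : ℕ → ℕ) (j : ℕ),
    P {ω | ∀ m ≤ k, η m ω = x m} ≠ 0 →
      P[{ω | η (k + 1) ω = j} | {ω | ∀ m ≤ k, η m ω = x m}]
        = ENNReal.ofReal (transProb lam mu (x k) j)

/-- `ν` is a (homogeneous) Poisson process with rate `α`. Since the paths are nondecreasing, the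
truncated subtraction of natural numbers is the true increment. -/
structure IsPoissonProcess {Ω : Type*} [MeasurableSpace Ω] (P : Measure Ω)
    (α : ℝ≥0) (ν : ℝ≥0 → Ω → ℕ) : Prop where
  measurable : ∀ t, Measurable (ν t)
  init : ∀ᵐ ω ∂P, ν 0 ω = 0
  path : ∀ᵐ ω ∂P, Monotone (fun t => ν t ω) ∧
    ∀ t, ContinuousWithinAt (fun s => ν s ω) (Set.Ici t) t
  indep_increments : HasIndepIncrements ν P
  law_increments : ∀ s t : ℝ≥0, s ≤ t →
    HasLaw (fun ω => ν t ω - ν s ω) (poissonMeasure (α * (t - s))) P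

/-- The time-changed chain `ξ(t) = η(ν(t))`. -/
def catastropheProcess {Ω : Type*} (η : ℕ → Ω → ℕ) (ν : ℝ≥0 → Ω → ℕ) (t : ℝ≥0) (ω : Ω) : ℕ :=
  η (ν t ω) ω

/-- The scaled process `ξ_T(t) = ξ(T t) / φ(T)`. -/
def scaledProcess {Ω : Type*} (ξ : ℝ≥0 → Ω → ℕ) (φ : ℝ≥0 → ℝ) (T t : ℝ≥0) (ω : Ω) : ℝ :=
  (ξ (T * t) ω : ℝ) / φ T

/-- The family of real random variables `X T` satisfies, as `T → ∞`, the large deviation principle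
on `ℝ` with normalizing function `ψ` and rate function `I`. The logarithm takes values in the
extended reals (`log 0 = -∞`), and the infimum over the empty set is `∞`. -/
structure SatisfiesLDP {Ω : Type*} [MeasurableSpace Ω] (P : Measure Ω)
    (X : ℝ≥0 → Ω → ℝ) (ψ : ℝ≥0 → ℝ) (I : ℝ → ℝ≥0∞) : Prop where
  tendsto_normalization : Tendsto ψ atTop atTop
  isCompact_sublevel : ∀ c : ℝ≥0, IsCompact {x : ℝ | I x ≤ c}
  upper_bound : ∀ B : Set ℝ, MeasurableSet B →
    limsup (fun T => ((1 / ψ T : ℝ) : EReal) * ENNReal.log (P {ω | X T ω ∈ B})) atTop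
      ≤ -((⨅ x ∈ closure B, I x : ℝ≥0∞) : EReal)
  lower_bound : ∀ B : Set ℝ, MeasurableSet B →
    -((⨅ x ∈ interior B, I x : ℝ≥0∞) : EReal)
      ≤ liminf (fun T => ((1 / ψ T : ℝ) : EReal) * ENNReal.log (P {ω | X T ω ∈ B})) atTop

/-- The rate function: `∞` on the negative half-line and `x ln ((lam + mu) / lam)` for `x ≥ 0`. -/
def rateI₁ (lam mu x : ℝ) : ℝ≥0∞ :=
  if x < 0 then ⊤ else ENNReal.ofReal (x * Real.log ((lam + mu) / lam))

end

/-! Write `p = lam / (lam + mu)`. The law of the chain has geometric tails of ratio `p`, uniformly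
in time, and the random clock cannot spoil this.

Upper bound: for `1 < z < 1 / p` the function `z ^ i` satisfies a drift inequality, since a
catastrophe from a high state `i` contributes only about `z ^ i / i`. Hence exponential moments are
bounded uniformly in time, and Markov's inequality gives tails `C z ^ (-x)` (`exists_tail_le`).
Averaging over `ν T` keeps this bound, and `z` may be taken close to `1 / p`.

Lower bound: tightness and a two-step return make the probability of being at `0` bounded below from
time 2 on; climbing `n` steps straight up costs at most a factor `p ^ n` (`exists_le_measure_eq`).
This needs at least `n + 2` jumps. With `n` of order `φ T = o(T)`, the Poisson clock has made them
with probability at least 1/2. Hitting one integer near `x * φ T` is then already optimal at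
exponential scale. -/

lemma measure_eq_tsum_inter_fiber {Ω ι : Type*} [MeasurableSpace Ω] [MeasurableSpace ι]
    [MeasurableSingletonClass ι] [Countable ι] (P : Measure Ω) {N : Ω → ι} (hN : Measurable N)
    {A : Set Ω} (hA : MeasurableSet A) : P A = ∑' i, P (A ∩ {ω | N ω = i}) := by
  rw [← measure_iUnion]
  · congr 1
    ext ω
    simp
  · intro i j hij
    rw [Function.onFun, Set.disjoint_left]
    rintro ω ⟨-, h⟩ ⟨-, h'⟩
    exact hij (h.symm.trans h')
  · exact fun i => hA.inter (hN (measurableSet_singleton i))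

lemma transProb_nonneg {lam mu : ℝ} (hlam : 0 < lam) (hmu : 0 < mu) (i j : ℕ) :
    0 ≤ transProb lam mu i j := by
  unfold transProb
  split_ifs <;> positivity

/-! ### One-step evolution of the law of the chain -/

namespace IsCatastropheChain

variable {Ω : Type*} [MeasurableSpace Ω] {P : Measure Ω} [IsProbabilityMeasure P] {lam mu : ℝ}
  {η : ℕ → Ω → ℕ}

/-- The Markov property is given conditionally on whole histories; summing over the histories that
end in `i` reduces it to the present state. -/
lemma measure_inter_succ (hη : IsCatastropheChain P lam mu η) (k i j : ℕ) :
    P ({ω | η k ω = i} ∩ {ω | η (k + 1) ω = j})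
      = P {ω | η k ω = i} * ENNReal.ofReal (transProb lam mu i j) := by
  have hE : ∀ k i, MeasurableSet {ω | η k ω = i} := fun k i =>
    hη.measurable k (measurableSet_singleton i)
  have hH : Measurable (fun ω (m : Fin (k + 1)) => η m ω) :=
    measurable_pi_lambda _ fun m => hη.measurable m
  rw [measure_eq_tsum_inter_fiber P hH ((hE k i).inter (hE (k + 1) j)),
    measure_eq_tsum_inter_fiber P hH (hE k i), ← ENNReal.tsum_mul_right]
  congr 1
  ext h
  by_cases hi : h (Fin.last k) = i
  -- The value 0 beyond time `k` is arbitrary: only indices `m ≤ k` are read.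
  · set x : ℕ → ℕ := fun m => if hm : m < k + 1 then h ⟨m, hm⟩ else 0 with hx
    have hset : {ω | (fun m : Fin (k + 1) => η m ω) = h} = {ω | ∀ m ≤ k, η m ω = x m} := by
      ext ω
      simp only [Set.mem_ofPred_eq, funext_iff, hx]
      constructor
      · intro H m hm
        rw [dif_pos (Nat.lt_succ_of_le hm)]
        exact H ⟨m, Nat.lt_succ_of_le hm⟩
      · intro H m
        have := H m (Nat.le_of_lt_succ m.2)
        rwa [dif_pos m.2] at this
    have hxk : x k = i := by
      simp only [hx, Nat.lt_succ_self, dite_true]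
      exact hi
    have hsub : {ω | ∀ m ≤ k, η m ω = x m} ⊆ {ω | η k ω = i} := fun ω hω => by
      have := hω k le_rfl
      rwa [hxk] at this
    have hmeas : MeasurableSet {ω | ∀ m ≤ k, η m ω = x m} := by
      rw [← hset]
      exact hH (measurableSet_singleton h)
    rw [hset, Set.inter_eq_right.2 hsub, Set.inter_right_comm, Set.inter_eq_right.2 hsub]
    by_cases h0 : P {ω | ∀ m ≤ k, η m ω = x m} = 0
    · rw [h0, zero_mul]
      exact measure_mono_null Set.inter_subset_left h0
    · have := hη.markov k x j h0
      rw [hxk] at this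
      rw [← this, mul_comm, cond_mul_eq_inter hmeas]
  · have h1 : {ω | η k ω = i} ∩ {ω | (fun m : Fin (k + 1) => η m ω) = h} = ∅ := by
      ext ω
      simp only [Set.mem_inter_iff, Set.mem_ofPred_eq, Set.mem_empty_iff_false, iff_false, not_and]
      rintro h1 rfl
      exact hi (by simpa using h1)
    rw [Set.inter_right_comm, h1]
    simp

lemma measure_mul_le_succ (hη : IsCatastropheChain P lam mu η) (k i j : ℕ) :
    P {ω | η k ω = i} * ENNReal.ofReal (transProb lam mu i j) ≤ P {ω | η (k + 1) ω = j} := by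
  rw [← hη.measure_inter_succ]
  exact measure_mono Set.inter_subset_right

lemma measure_succ_eq_tsum (hη : IsCatastropheChain P lam mu η) (k j : ℕ) :
    P {ω | η (k + 1) ω = j}
      = ∑' i, P {ω | η k ω = i} * ENNReal.ofReal (transProb lam mu i j) := by
  have hE : MeasurableSet {ω | η (k + 1) ω = j} :=
    hη.measurable (k + 1) (measurableSet_singleton j)
  rw [measure_eq_tsum_inter_fiber P (hη.measurable k) hE]
  congr 1
  ext i
  rw [← hη.measure_inter_succ, Set.inter_comm]

end IsCatastropheChain

/-! ### Uniform geometric bounds for the chain -/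

/-- The functions `i ↦ z ^ i` with `1 < z < (lam + mu) / lam` satisfy a geometric drift condition
for the catastrophe chain. -/
lemma exists_drift {lam mu z : ℝ} (hlam : 0 < lam) (hmu : 0 < mu) (hz : 1 < z)
    (hz' : lam / (lam + mu) * z < 1) :
    ∃ ρ K : ℝ, 0 < ρ ∧ ρ < 1 ∧ 0 < K ∧ ∀ i : ℕ,
      ∑ j ∈ Finset.range (i + 2), transProb lam mu i j * z ^ j ≤ ρ * z ^ i + K := by
  set p := lam / (lam + mu) with hp
  have hp0 : 0 < p := by positivity
  have hz1 : 0 < z - 1 := by linarith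
  have hz0 : 0 < z := by linarith
  -- For `i ≥ N` the catastrophe term is at most `(1 - p * z) / 2 * z ^ i`, which added to the
  -- upward term `p * z * z ^ i` gives the midpoint `ρ = (1 + p * z) / 2`. Smaller `i` are absorbed
  -- by `z ^ N / (z - 1)`; the extra `z` covers the forced jump from 0.
  obtain ⟨N, hN⟩ := exists_nat_gt (2 / ((z - 1) * (1 - p * z)))
  have hpz : 0 < p * z := by positivity
  have hpz1 : 0 < 1 - p * z := by linarith
  refine ⟨(1 + p * z) / 2, z ^ N / (z - 1) + z, by positivity, by linarith, by positivity, ?_⟩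
  intro i
  rcases Nat.eq_zero_or_pos i with rfl | hi
  · simp only [zero_add, transProb, Finset.sum_range_succ]
    norm_num
    have : 0 < z ^ N / (z - 1) := by positivity
    nlinarith
  · have hi' : (1 : ℝ) ≤ i := by exact_mod_cast hi
    have hq : mu / (lam + mu) ≤ 1 := (div_le_one (by positivity)).2 (by linarith)
    have hsum : ∑ j ∈ Finset.range (i + 2), transProb lam mu i j * z ^ j
        = mu / (i * (lam + mu)) * ((z ^ i - 1) / (z - 1)) + p * z * z ^ i := by
      rw [Finset.sum_range_succ, Finset.sum_range_succ, ← geom_sum_eq hz.ne', Finset.mul_sum]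
      have h1 : transProb lam mu i i = 0 := by simp [transProb, hi.ne']
      have h2 : transProb lam mu i (i + 1) = p := by simp [transProb, hi.ne', hp]
      rw [h1, h2, pow_succ]
      have h3 : ∑ j ∈ Finset.range i, transProb lam mu i j * z ^ j
          = ∑ j ∈ Finset.range i, mu / (i * (lam + mu)) * z ^ j := by
        refine Finset.sum_congr rfl fun j hj => ?_
        have hj := Finset.mem_range.1 hj
        have : transProb lam mu i j = mu / (i * (lam + mu)) := by
          rw [transProb, if_neg hi.ne', if_neg (by omega), if_pos hj]
        rw [this]
      rw [h3]
      ring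
    have hle : mu / (i * (lam + mu)) * ((z ^ i - 1) / (z - 1)) ≤ 1 / i * (z ^ i / (z - 1)) := by
      have h1 : mu / (i * (lam + mu)) = mu / (lam + mu) * (1 / i) := by field_simp
      have h2 : mu / (i * (lam + mu)) ≤ 1 / i := by
        rw [h1]
        exact mul_le_of_le_one_left (by positivity) hq
      have h3 : 0 ≤ (z ^ i - 1) / (z - 1) :=
        div_nonneg (by linarith [one_le_pow₀ (n := i) hz.le]) hz1.le
      exact mul_le_mul h2 (by gcongr; linarith) h3 (by positivity)
    rw [hsum]
    have hzi : 0 < z ^ i := by positivity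
    by_cases hiN : i < N
    · have h1 : 1 / (i : ℝ) * (z ^ i / (z - 1)) ≤ z ^ N / (z - 1) := by
        calc 1 / (i : ℝ) * (z ^ i / (z - 1)) ≤ z ^ i / (z - 1) :=
              mul_le_of_le_one_left (by positivity) ((div_le_one (by linarith)).2 hi')
          _ ≤ z ^ N / (z - 1) := by gcongr; exact hz.le
      nlinarith
    · have hNi : (N : ℝ) ≤ i := by exact_mod_cast not_lt.1 hiN
      have h1 : 1 / (i : ℝ) * (z ^ i / (z - 1)) ≤ (1 - p * z) / 2 * z ^ i := by
        have h2 : 2 < i * ((z - 1) * (1 - p * z)) := (div_lt_iff₀ (by positivity)).1 (hN.trans_le hNi)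
        rw [show 1 / (i : ℝ) * (z ^ i / (z - 1)) = z ^ i / (i * (z - 1)) by field_simp,
          div_le_iff₀ (by positivity)]
        nlinarith
      have : 0 < z ^ N / (z - 1) := by positivity
      nlinarith

namespace IsCatastropheChain

variable {Ω : Type*} [MeasurableSpace Ω] {P : Measure Ω} [IsProbabilityMeasure P] {lam mu : ℝ}
  {η : ℕ → Ω → ℕ}

lemma exists_expMoment_le (hη : IsCatastropheChain P lam mu η) (hlam : 0 < lam) (hmu : 0 < mu)
    {z : ℝ} (hz : 1 < z) (hz' : lam / (lam + mu) * z < 1) :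
    ∃ C : ℝ, 0 < C ∧ ∀ k, ∑' i, P {ω | η k ω = i} * ENNReal.ofReal (z ^ i) ≤ ENNReal.ofReal C := by
  obtain ⟨ρ, K, hρ, hρ1, hK, hdrift⟩ := exists_drift hlam hmu hz hz'
  have h1ρ : 0 < 1 - ρ := by linarith
  have hz0 : 0 < z := by linarith
  -- `K / (1 - ρ)` is the fixed point of `m ↦ ρ * m + K`; the added 1 is the initial moment.
  refine ⟨1 + K / (1 - ρ), by positivity, fun k => ?_⟩
  have htot : ∀ k, ∑' i, P {ω | η k ω = i} = 1 := fun k => by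
    have := measure_eq_tsum_inter_fiber P (hη.measurable k) MeasurableSet.univ
    simpa using this.symm
  induction k with
  | zero =>
    rw [tsum_eq_single 0]
    · rw [pow_zero, ENNReal.ofReal_one, mul_one]
      refine prob_le_one.trans ?_
      rw [ENNReal.one_le_ofReal]
      have : 0 < K / (1 - ρ) := by positivity
      linarith
    · intro i hi
      have : P {ω | η 0 ω = i} = 0 :=
        measure_mono_null (fun ω hω h0 => hi (hω.symm.trans h0)) hη.init
      rw [this, zero_mul]
  | succ k ih =>
    have hinner : ∀ i, ∑' j, ENNReal.ofReal (transProb lam mu i j) * ENNReal.ofReal (z ^ j)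
        ≤ ENNReal.ofReal ρ * ENNReal.ofReal (z ^ i) + ENNReal.ofReal K := fun i => by
      rw [tsum_eq_sum (s := Finset.range (i + 2)), ← ENNReal.ofReal_mul hρ.le,
        ← ENNReal.ofReal_add (by positivity) hK.le]
      · simp_rw [← ENNReal.ofReal_mul (transProb_nonneg hlam hmu _ _)]
        rw [← ENNReal.ofReal_sum_of_nonneg]
        · exact ENNReal.ofReal_le_ofReal (hdrift i)
        · exact fun j _ => mul_nonneg (transProb_nonneg hlam hmu _ _) (by positivity)
      · intro j hj
        have hj : i + 2 ≤ j := by simpa using hj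
        have : transProb lam mu i j = 0 := by
          unfold transProb
          split_ifs <;> first | rfl | omega
        simp [this]
    calc ∑' j, P {ω | η (k + 1) ω = j} * ENNReal.ofReal (z ^ j)
        = ∑' j, ∑' i, P {ω | η k ω = i} *
            (ENNReal.ofReal (transProb lam mu i j) * ENNReal.ofReal (z ^ j)) := by
          simp_rw [hη.measure_succ_eq_tsum, ← ENNReal.tsum_mul_right, mul_assoc]
      _ = ∑' i, P {ω | η k ω = i} *
            ∑' j, ENNReal.ofReal (transProb lam mu i j) * ENNReal.ofReal (z ^ j) := by
          rw [ENNReal.tsum_comm]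
          simp_rw [ENNReal.tsum_mul_left]
      _ ≤ ∑' i, P {ω | η k ω = i} *
            (ENNReal.ofReal ρ * ENNReal.ofReal (z ^ i) + ENNReal.ofReal K) :=
          ENNReal.tsum_le_tsum fun i => by gcongr; exact hinner i
      _ = ENNReal.ofReal ρ * ∑' i, P {ω | η k ω = i} * ENNReal.ofReal (z ^ i)
            + ENNReal.ofReal K := by
          simp_rw [mul_add, ENNReal.tsum_add, ENNReal.tsum_mul_right, htot, one_mul,
            ← ENNReal.tsum_mul_left, mul_left_comm]
      _ ≤ ENNReal.ofReal ρ * ENNReal.ofReal (1 + K / (1 - ρ)) + ENNReal.ofReal K := by gcongr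
      _ = ENNReal.ofReal (ρ * (1 + K / (1 - ρ)) + K) := by
          rw [← ENNReal.ofReal_mul hρ.le, ← ENNReal.ofReal_add (by positivity) hK.le]
      _ ≤ ENNReal.ofReal (1 + K / (1 - ρ)) := by
          refine ENNReal.ofReal_le_ofReal ?_
          have : ρ * (1 + K / (1 - ρ)) + K = ρ + K / (1 - ρ) := by field_simp; ring
          linarith

lemma exists_tail_le (hη : IsCatastropheChain P lam mu η) (hlam : 0 < lam) (hmu : 0 < mu)
    {z : ℝ} (hz : 1 < z) (hz' : lam / (lam + mu) * z < 1) :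
    ∃ C : ℝ, 0 < C ∧ ∀ k (x : ℝ),
      P {ω | x ≤ η k ω} ≤ ENNReal.ofReal (C * Real.exp (-(x * Real.log z))) := by
  obtain ⟨C, hC, h⟩ := hη.exists_expMoment_le hlam hmu hz hz'
  have hz0 : 0 < z := by linarith
  refine ⟨C, hC, fun k x => ?_⟩
  have key : P {ω | x ≤ η k ω} * ENNReal.ofReal (Real.exp (x * Real.log z)) ≤ ENNReal.ofReal C := by
    refine le_trans ?_ (h k)
    have hE : MeasurableSet {ω | x ≤ η k ω} :=
      hη.measurable k (MeasurableSet.of_discrete (s := {i : ℕ | x ≤ i}))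
    rw [measure_eq_tsum_inter_fiber P (hη.measurable k) hE, ← ENNReal.tsum_mul_right]
    refine ENNReal.tsum_le_tsum fun i => ?_
    by_cases hi : x ≤ i
    · gcongr ?_ * ENNReal.ofReal ?_
      · exact measure_mono Set.inter_subset_right
      · rw [← Real.exp_log (pow_pos hz0 i), Real.exp_le_exp, Real.log_pow]
        exact mul_le_mul_of_nonneg_right hi (Real.log_nonneg hz.le)
    · have : {ω | x ≤ η k ω} ∩ {ω | η k ω = i} = ∅ := by
        ext ω
        simp only [Set.mem_inter_iff, Set.mem_ofPred_eq, Set.mem_empty_iff_false, iff_false,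
          not_and]
        rintro h1 rfl
        exact hi h1
      simp [this]
  rw [ENNReal.ofReal_mul hC.le, Real.exp_neg, ENNReal.ofReal_inv_of_pos (Real.exp_pos _),
    ← div_eq_mul_inv]
  exact (ENNReal.le_div_iff_mul_le (Or.inl (by simp [Real.exp_pos])) (Or.inl (by simp))).2 key

/-- By the uniform tail bound, at each time some state below a fixed `M` has mass bounded below, and
each such state returns to 0 in exactly two steps with probability bounded below. -/
lemma exists_le_measure_zero (hη : IsCatastropheChain P lam mu η) (hlam : 0 < lam) (hmu : 0 < mu) :
    ∃ c : ℝ, 0 < c ∧ ∀ k, ENNReal.ofReal c ≤ P {ω | η (k + 2) ω = 0} := by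
  set p := lam / (lam + mu) with hp
  set q := mu / (lam + mu) with hq
  have hp0 : 0 < p := by positivity
  have hq0 : 0 < q := by positivity
  have hpq : p + q = 1 := by rw [hp, hq]; field_simp
  have hp1 : p < 1 := by linarith
  obtain ⟨z, hz, hz'⟩ := exists_between ((one_lt_div hp0).2 hp1)
  obtain ⟨C, hC, h⟩ := hη.exists_tail_le hlam hmu hz
    (by rw [mul_comm]; exact (lt_div_iff₀ hp0).1 hz')
  have hlz := Real.log_pos hz
  obtain ⟨M, hM⟩ : ∃ M : ℕ, C * Real.exp (-(M * Real.log z)) ≤ 1 / 2 := by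
    have : Tendsto (fun M : ℕ => C * Real.exp (-(M * Real.log z))) atTop (𝓝 (C * 0)) :=
      (Real.tendsto_exp_neg_atTop_nhds_zero.comp
        (tendsto_natCast_atTop_atTop.atTop_mul_const hlz)).const_mul C
    rw [mul_zero] at this
    exact (this.eventually (ge_mem_nhds (by norm_num))).exists
  have htwo : ∀ k i j, P {ω | η k ω = i} *
      ENNReal.ofReal (transProb lam mu i j * transProb lam mu j 0) ≤ P {ω | η (k + 2) ω = 0} :=
    fun k i j => by
      rw [ENNReal.ofReal_mul (transProb_nonneg hlam hmu _ _), ← mul_assoc]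
      refine le_trans ?_ (hη.measure_mul_le_succ (k + 1) j 0)
      gcongr
      exact hη.measure_mul_le_succ k i j
  have hreturn : ∃ d : ℝ, 0 < d ∧ ∀ i < M, ∃ j,
      d ≤ transProb lam mu i j * transProb lam mu j 0 := by
    -- The routes are 0 → 1 → 0, 1 → 2 → 0 (state 1 cannot stay put), and i → 1 → 0 for `i ≥ 2`.
    refine ⟨min (p * q / 2) (q * q / (M + 1)), by positivity, fun i hi => ?_⟩
    have h10 : transProb lam mu 1 0 = q := by simp [transProb, hq]
    have hM1 : (1 : ℝ) ≤ M + 1 := by linarith [(Nat.cast_nonneg M : (0 : ℝ) ≤ M)]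
    have hqqM : q * q / (M + 1) ≤ q * q := div_le_self (by positivity) hM1
    match i with
    | 0 =>
      refine ⟨1, (min_le_right _ _).trans ?_⟩
      rw [h10]
      simp only [transProb, if_true]
      nlinarith
    | 1 =>
      refine ⟨2, (min_le_left _ _).trans (le_of_eq ?_)⟩
      have h12 : transProb lam mu 1 2 = p := by simp [transProb, hp]
      have h20 : transProb lam mu 2 0 = q / 2 := by
        simp [transProb, hq]
        field_simp
      rw [h12, h20]
      ring
    | i + 2 =>
      refine ⟨1, (min_le_right _ _).trans ?_⟩
      have h1 : transProb lam mu (i + 2) 1 = q / ((i + 2 : ℕ) : ℝ) := by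
        rw [transProb, if_neg (by omega), if_neg (by omega), if_pos (by omega), hq]
        field_simp
      rw [h1, h10, div_mul_eq_mul_div q ((i + 2 : ℕ) : ℝ) q]
      have : ((i + 2 : ℕ) : ℝ) ≤ M + 1 := by exact_mod_cast (by omega : i + 2 ≤ M + 1)
      exact div_le_div_of_nonneg_left (by positivity) (by positivity) this
  obtain ⟨d, hd, hreturn⟩ := hreturn
  refine ⟨1 / 2 / (M + 1) * d, by positivity, fun k => ?_⟩
  obtain ⟨i, hiM, hi⟩ : ∃ i < M, ENNReal.ofReal (1 / 2 / (M + 1)) ≤ P {ω | η k ω = i} := by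
    by_contra! hcon
    have hlow : P {ω | η k ω < M} ≤ ENNReal.ofReal (M * (1 / 2 / (M + 1))) := by
      have hU : {ω | η k ω < M} = ⋃ i ∈ Finset.range M, {ω | η k ω = i} := by
        ext ω
        simp
      rw [hU]
      refine (measure_biUnion_finset_le _ _).trans ?_
      refine (Finset.sum_le_sum fun i hi => (hcon i (Finset.mem_range.1 hi)).le).trans ?_
      rw [Finset.sum_const, Finset.card_range, nsmul_eq_mul, ENNReal.ofReal_mul (by positivity),
        ENNReal.ofReal_natCast]
    have hhigh : P {ω | (M : ℝ) ≤ η k ω} ≤ ENNReal.ofReal (1 / 2) :=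
      (h k M).trans (ENNReal.ofReal_le_ofReal hM)
    have hone : (1 : ℝ≥0∞) ≤ ENNReal.ofReal (M * (1 / 2 / (M + 1)) + 1 / 2) := by
      rw [ENNReal.ofReal_add (by positivity) (by positivity)]
      refine le_trans ?_ (add_le_add hlow hhigh)
      refine le_trans ?_ (measure_union_le _ _)
      rw [← measure_univ (μ := P)]
      refine measure_mono fun ω _ => ?_
      simp only [Set.mem_union, Set.mem_ofPred_eq, Nat.cast_le]
      exact lt_or_ge _ _
    rw [ENNReal.one_le_ofReal] at hone
    have : (M : ℝ) * (1 / 2 / (M + 1)) < 1 / 2 := by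
      have : (0 : ℝ) < M + 1 := by positivity
      rw [mul_div_assoc', div_lt_iff₀ this]
      linarith
    linarith
  obtain ⟨j, hj⟩ := hreturn i hiM
  rw [ENNReal.ofReal_mul (by positivity)]
  refine le_trans ?_ (htwo k i j)
  gcongr

/-- Be at 0 at time `k - n ≥ 2`, then go up `n` times; each step has probability at least `p`, the
one from 0 having probability 1. -/
lemma exists_le_measure_eq (hη : IsCatastropheChain P lam mu η) (hlam : 0 < lam) (hmu : 0 < mu) :
    ∃ c : ℝ, 0 < c ∧ ∀ n k, n + 2 ≤ k →
      ENNReal.ofReal (c * (lam / (lam + mu)) ^ n) ≤ P {ω | η k ω = n} := by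
  obtain ⟨c, hc, h⟩ := hη.exists_le_measure_zero hlam hmu
  refine ⟨c, hc, fun n => ?_⟩
  induction n with
  | zero =>
    intro k hk
    obtain ⟨k, rfl⟩ := Nat.exists_eq_add_of_le' hk
    simpa using h k
  | succ n ih =>
    intro k hk
    obtain ⟨k, rfl⟩ := Nat.exists_eq_add_of_le' (by omega : 1 ≤ k)
    refine le_trans ?_ (hη.measure_mul_le_succ k n (n + 1))
    rw [pow_succ, ← mul_assoc, ENNReal.ofReal_mul (by positivity)]
    gcongr
    · exact ih k (by omega)
    · rcases Nat.eq_zero_or_pos n with rfl | hn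
      · simp only [transProb, if_true]
        exact (div_le_one (by positivity)).2 (by linarith)
      · simp [transProb, hn.ne']

end IsCatastropheChain

/-! ### The Poisson clock -/

lemma poissonMeasure_lt_le (r : ℝ≥0) (m : ℕ) :
    poissonMeasure r {j | j < m} ≤ ENNReal.ofReal (2 ^ m * Real.exp (-(r / 2))) := by
  have hset : {j | j < m} = ((Finset.range m : Finset ℕ) : Set ℕ) := by
    ext j
    simp
  rw [hset, ← sum_measure_singleton]
  simp_rw [poissonMeasure_singleton]
  rw [← ENNReal.ofReal_sum_of_nonneg fun _ _ => by positivity]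
  refine ENNReal.ofReal_le_ofReal ?_
  -- Chernoff's method with weight `2 ^ (m - j) ≥ 1`: tilting the rate from `r` to `r / 2` leaves
  -- the factor `Real.exp (r / 2)`.
  calc ∑ j ∈ Finset.range m, Real.exp (-r) * r ^ j / (j.factorial : ℝ)
      ≤ ∑ j ∈ Finset.range m, Real.exp (-r) * 2 ^ m * ((r / 2 : ℝ) ^ j / j.factorial) := by
        refine Finset.sum_le_sum fun j hj => ?_
        have hj : (2 : ℝ) ^ j ≤ 2 ^ m :=
          pow_le_pow_right₀ (by norm_num) (Finset.mem_range.1 hj).le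
        have : Real.exp (-r) * r ^ j / (j.factorial : ℝ)
            = Real.exp (-r) * 2 ^ j * ((r / 2 : ℝ) ^ j / j.factorial) := by
          rw [div_pow]
          field_simp
        rw [this]
        gcongr
    _ = Real.exp (-r) * 2 ^ m * ∑ j ∈ Finset.range m, (r / 2 : ℝ) ^ j / j.factorial := by
        rw [Finset.mul_sum]
    _ ≤ Real.exp (-r) * 2 ^ m * Real.exp (r / 2) := by
        gcongr
        exact Real.sum_le_exp_of_nonneg (by positivity) m
    _ = 2 ^ m * Real.exp (-(r / 2)) := by
        rw [mul_right_comm, ← Real.exp_add, mul_comm]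
        ring_nf

lemma IsPoissonProcess.eventually_lt_le_half {Ω : Type*} [MeasurableSpace Ω] {P : Measure Ω}
    {α : ℝ≥0} {ν : ℝ≥0 → Ω → ℕ} (hν : IsPoissonProcess P α ν) (hα : 0 < α) {m : ℝ≥0 → ℕ}
    (hm : Tendsto (fun T : ℝ≥0 => (m T : ℝ) / T) atTop (𝓝 0)) :
    ∀ᶠ T in atTop, P {ω | ν T ω < m T} ≤ ENNReal.ofReal (1 / 2) := by
  have hα' : (0 : ℝ) < α := hα
  -- These two thresholds make the exponent `m T - α * T / 2` at most `-α * T / 4 ≤ -1`.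
  filter_upwards [hm.eventually (gt_mem_nhds (by positivity : (0 : ℝ) < α / 4)),
    eventually_ge_atTop (4 / α)] with T hT hT4
  have hT4' : (4 : ℝ) / α ≤ T := by exact_mod_cast hT4
  have hT0 : (0 : ℝ) < T := lt_of_lt_of_le (by positivity) hT4'
  rw [div_lt_iff₀ hT0] at hT
  rw [div_le_iff₀ hα'] at hT4'
  have hlaw : P {ω | ν T ω < m T} = poissonMeasure (α * T) {j | j < m T} := by
    have h := (hν.law_increments 0 T zero_le).measure_eq
      (p := fun j => j < m T) MeasurableSet.of_discrete
    rw [tsub_zero] at h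
    rw [← h]
    refine measure_congr (eventuallyEq_set.2 ?_)
    filter_upwards [hν.init] with ω hω
    simp only [hω, tsub_zero]
  rw [hlaw]
  refine (poissonMeasure_lt_le _ _).trans (ENNReal.ofReal_le_ofReal ?_)
  have h2 : (2 : ℝ) ≤ Real.exp 1 := by linarith [Real.add_one_le_exp 1]
  calc (2 : ℝ) ^ m T * Real.exp (-((α * T : ℝ≥0) / 2))
      ≤ Real.exp 1 ^ m T * Real.exp (-((α * T : ℝ≥0) / 2)) := by gcongr
    _ = Real.exp (m T - α * T / 2) := by
        rw [← Real.exp_nat_mul, ← Real.exp_add]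
        push_cast
        ring_nf
    _ ≤ Real.exp (-1) := Real.exp_le_exp.2 (by linarith)
    _ ≤ 1 / 2 := by
        rw [Real.exp_neg, one_div]
        exact inv_anti₀ (by norm_num) h2

/-! ### Transfer to the time-changed process by independence -/

section TimeChange

variable {Ω : Type*} [MeasurableSpace Ω] {P : Measure Ω} {lam mu : ℝ}
  {η : ℕ → Ω → ℕ} {ν : ℝ≥0 → Ω → ℕ}

lemma measure_catastropheProcess_mem (hη : ∀ k, Measurable (η k)) (hν : ∀ t, Measurable (ν t))
    (hην : IndepFun (fun ω k => η k ω) (fun ω t => ν t ω) P) (T : ℝ≥0) (S : Set ℕ) :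
    P {ω | catastropheProcess η ν T ω ∈ S}
      = ∑' k, P {ω | ν T ω = k} * P {ω | η k ω ∈ S} := by
  have hpre : {ω | catastropheProcess η ν T ω ∈ S} = ⋃ k, {ω | ν T ω = k} ∩ {ω | η k ω ∈ S} := by
    ext ω
    simp [catastropheProcess]
  have hmν : ∀ k, MeasurableSet {ω | ν T ω = k} := fun k => hν T (measurableSet_singleton k)
  have hmη : ∀ k, MeasurableSet {ω | η k ω ∈ S} := fun k =>
    hη k (MeasurableSet.of_discrete (s := S))
  have hmeas : MeasurableSet {ω | catastropheProcess η ν T ω ∈ S} := by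
    rw [hpre]
    exact MeasurableSet.iUnion fun k => (hmν k).inter (hmη k)
  rw [measure_eq_tsum_inter_fiber P (hν T) hmeas]
  congr 1
  ext k
  have hind : IndepFun (η k) (ν T) P := hην.comp (measurable_pi_apply k) (measurable_pi_apply T)
  rw [mul_comm]
  refine Eq.trans ?_ (hind.measure_inter_preimage_eq_mul S {k} MeasurableSet.of_discrete
    MeasurableSet.of_discrete)
  congr 1
  ext ω
  simp only [catastropheProcess, Set.mem_inter_iff, Set.mem_ofPred_eq, Set.mem_preimage,
    Set.mem_singleton_iff]
  constructor
  · rintro ⟨h, rfl⟩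
    exact ⟨h, rfl⟩
  · rintro ⟨h, rfl⟩
    exact ⟨h, rfl⟩

variable [IsProbabilityMeasure P]

lemma exists_catastropheProcess_tail_le (hη : IsCatastropheChain P lam mu η)
    (hν : ∀ t, Measurable (ν t)) (hην : IndepFun (fun ω k => η k ω) (fun ω t => ν t ω) P)
    (hlam : 0 < lam) (hmu : 0 < mu) {z : ℝ} (hz : 1 < z) (hz' : lam / (lam + mu) * z < 1) :
    ∃ C : ℝ, 0 < C ∧ ∀ T (x : ℝ), P {ω | x ≤ catastropheProcess η ν T ω}
      ≤ ENNReal.ofReal (C * Real.exp (-(x * Real.log z))) := by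
  obtain ⟨C, hC, h⟩ := hη.exists_tail_le hlam hmu hz hz'
  refine ⟨C, hC, fun T x => ?_⟩
  have hmix := measure_catastropheProcess_mem hη.measurable hν hην T {i : ℕ | x ≤ i}
  simp only [Set.mem_ofPred_eq] at hmix
  have htot : ∑' k, P {ω | ν T ω = k} = 1 := by
    simpa using (measure_eq_tsum_inter_fiber P (hν T) MeasurableSet.univ).symm
  rw [hmix]
  calc ∑' k, P {ω | ν T ω = k} * P {ω | x ≤ η k ω}
      ≤ ∑' k, P {ω | ν T ω = k} * ENNReal.ofReal (C * Real.exp (-(x * Real.log z))) :=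
        ENNReal.tsum_le_tsum fun k => by gcongr; exact h k x
    _ = ENNReal.ofReal (C * Real.exp (-(x * Real.log z))) := by
        rw [ENNReal.tsum_mul_right, htot, one_mul]

lemma exists_le_catastropheProcess_eq (hη : IsCatastropheChain P lam mu η)
    (hν : ∀ t, Measurable (ν t)) (hην : IndepFun (fun ω k => η k ω) (fun ω t => ν t ω) P)
    (hlam : 0 < lam) (hmu : 0 < mu) :
    ∃ c : ℝ, 0 < c ∧ ∀ T n, P {ω | ν T ω < n + 2} ≤ ENNReal.ofReal (1 / 2) →
      ENNReal.ofReal (c * (lam / (lam + mu)) ^ n) ≤ P {ω | catastropheProcess η ν T ω = n} := by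
  obtain ⟨c, hc, h⟩ := hη.exists_le_measure_eq hlam hmu
  refine ⟨1 / 2 * c, by positivity, fun T n hT => ?_⟩
  have hmix := measure_catastropheProcess_mem hη.measurable hν hην T {n}
  simp only [Set.mem_singleton_iff] at hmix
  have hge : MeasurableSet {ω | n + 2 ≤ ν T ω} :=
    hν T (MeasurableSet.of_discrete (s := {i : ℕ | n + 2 ≤ i}))
  have hhalf : ENNReal.ofReal (1 / 2) ≤ P {ω | n + 2 ≤ ν T ω} := by
    have hcompl : {ω | n + 2 ≤ ν T ω}ᶜ = {ω | ν T ω < n + 2} := by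
      ext ω
      simp
    have hadd := prob_add_prob_compl (μ := P) hge
    rw [hcompl] at hadd
    have hone : ENNReal.ofReal (1 / 2) + ENNReal.ofReal (1 / 2) = 1 := by
      rw [← ENNReal.ofReal_add (by norm_num) (by norm_num)]
      norm_num
    have hle : ENNReal.ofReal (1 / 2) + ENNReal.ofReal (1 / 2)
        ≤ P {ω | n + 2 ≤ ν T ω} + ENNReal.ofReal (1 / 2) := by
      rw [hone, ← hadd]
      gcongr
    exact (ENNReal.add_le_add_iff_right ENNReal.ofReal_ne_top).1 hle
  rw [hmix, mul_assoc, ENNReal.ofReal_mul (by norm_num)]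
  calc ENNReal.ofReal (1 / 2) * ENNReal.ofReal (c * (lam / (lam + mu)) ^ n)
      ≤ P {ω | n + 2 ≤ ν T ω} * ENNReal.ofReal (c * (lam / (lam + mu)) ^ n) := by gcongr
    _ = ∑' k, P ({ω | n + 2 ≤ ν T ω} ∩ {ω | ν T ω = k})
          * ENNReal.ofReal (c * (lam / (lam + mu)) ^ n) := by
        rw [measure_eq_tsum_inter_fiber P (hν T) hge, ENNReal.tsum_mul_right]
    _ ≤ ∑' k, P {ω | ν T ω = k} * P {ω | η k ω = n} := by
        refine ENNReal.tsum_le_tsum fun k => ?_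
        by_cases hk : n + 2 ≤ k
        · gcongr
          · exact Set.inter_subset_right
          · exact h n k hk
        · have : {ω | n + 2 ≤ ν T ω} ∩ {ω | ν T ω = k} = ∅ := by
            ext ω
            simp only [Set.mem_inter_iff, Set.mem_ofPred_eq, Set.mem_empty_iff_false, iff_false,
              not_and]
            rintro h1 rfl
            exact hk h1
          simp [this]

end TimeChange

/-! ### The large deviation principle -/

lemma isCompact_rateI₁_le {lam mu : ℝ} (hl : 0 < Real.log ((lam + mu) / lam)) (c : ℝ≥0) :
    IsCompact {x : ℝ | rateI₁ lam mu x ≤ c} := by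
  have : {x : ℝ | rateI₁ lam mu x ≤ c} = Set.Icc 0 (c / Real.log ((lam + mu) / lam)) := by
    ext x
    simp only [rateI₁, Set.mem_ofPred_eq, Set.mem_Icc]
    split_ifs with hx
    · simp [hx]
    · rw [ENNReal.ofReal_le_iff_le_toReal ENNReal.coe_ne_top, ENNReal.coe_toReal,
        le_div_iff₀ hl]
      exact ⟨fun h => ⟨not_lt.1 hx, h⟩, fun h => h.2⟩
  rw [this]
  exact isCompact_Icc

lemma tendsto_atTop_of_div_rpow {φ : ℝ≥0 → ℝ} {a : ℝ} (ha : 0 < a)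
    (h : Tendsto (fun T : ℝ≥0 => φ T / (T : ℝ) ^ a) atTop atTop) : Tendsto φ atTop atTop := by
  have hT : Tendsto (fun T : ℝ≥0 => (T : ℝ) ^ a) atTop atTop :=
    (tendsto_rpow_atTop ha).comp (NNReal.tendsto_coe_atTop.2 tendsto_id)
  refine (h.atTop_mul_atTop₀ hT).congr' ?_
  filter_upwards [eventually_gt_atTop 0] with T hT
  have : (0 : ℝ) < (T : ℝ) ^ a := Real.rpow_pos_of_pos hT a
  field_simp

/-- An eventual exponential upper bound on probabilities controls the normalized logarithms. -/
lemma limsup_log_le_of_eventually_le {ψ : ℝ≥0 → ℝ} (hψ : Tendsto ψ atTop atTop) {Q : ℝ≥0 → ℝ≥0∞}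
    {C r : ℝ} (hC : 0 < C)
    (hQ : ∀ᶠ T in atTop, Q T ≤ ENNReal.ofReal (C * Real.exp (-(r * ψ T)))) :
    limsup (fun T => ((1 / ψ T : ℝ) : EReal) * ENNReal.log (Q T)) atTop ≤ ((-r : ℝ) : EReal) := by
  have hlim : Tendsto (fun T => ((Real.log C / ψ T - r : ℝ) : EReal)) atTop
      (𝓝 ((-r : ℝ) : EReal)) := by
    rw [EReal.tendsto_coe]
    simpa using (hψ.const_div_atTop (Real.log C)).sub_const r
  rw [← hlim.limsup_eq]
  refine limsup_le_limsup ?_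
  filter_upwards [hQ, hψ.eventually_gt_atTop 0] with T hT hψT
  calc ((1 / ψ T : ℝ) : EReal) * ENNReal.log (Q T)
      ≤ ((1 / ψ T : ℝ) : EReal) * ENNReal.log (ENNReal.ofReal (C * Real.exp (-(r * ψ T)))) :=
        mul_le_mul_of_nonneg_left (ENNReal.log_le_log hT)
          (EReal.coe_nonneg.2 (by positivity))
    _ = ((Real.log C / ψ T - r : ℝ) : EReal) := by
        rw [ENNReal.log_ofReal_of_pos (by positivity),
          Real.log_mul hC.ne' (Real.exp_pos _).ne', Real.log_exp, ← EReal.coe_mul]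
        congr 1
        field_simp
        ring

/-- An eventual exponential lower bound on probabilities controls the normalized logarithms. -/
lemma le_liminf_log_of_eventually_le {ψ : ℝ≥0 → ℝ} (hψ : Tendsto ψ atTop atTop) {Q : ℝ≥0 → ℝ≥0∞}
    {c p x : ℝ} (hc : 0 < c) (hp : 0 < p) {n : ℝ≥0 → ℕ}
    (hn : Tendsto (fun T => (n T : ℝ) / ψ T) atTop (𝓝 x))
    (hQ : ∀ᶠ T in atTop, ENNReal.ofReal (c * p ^ n T) ≤ Q T) :
    ((x * Real.log p : ℝ) : EReal)
      ≤ liminf (fun T => ((1 / ψ T : ℝ) : EReal) * ENNReal.log (Q T)) atTop := by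
  have hlim : Tendsto (fun T => ((Real.log c / ψ T + n T / ψ T * Real.log p : ℝ) : EReal)) atTop
      (𝓝 ((x * Real.log p : ℝ) : EReal)) := by
    rw [EReal.tendsto_coe]
    simpa using (hψ.const_div_atTop (Real.log c)).add (hn.mul_const (Real.log p))
  rw [← hlim.liminf_eq]
  refine liminf_le_liminf ?_
  filter_upwards [hQ, hψ.eventually_gt_atTop 0] with T hT hψT
  calc ((Real.log c / ψ T + n T / ψ T * Real.log p : ℝ) : EReal)
      = ((1 / ψ T : ℝ) : EReal) * ENNReal.log (ENNReal.ofReal (c * p ^ n T)) := by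
        rw [ENNReal.log_ofReal_of_pos (by positivity),
          Real.log_mul hc.ne' (pow_pos hp _).ne', Real.log_pow, ← EReal.coe_mul]
        congr 1
        field_simp
    _ ≤ ((1 / ψ T : ℝ) : EReal) * ENNReal.log (Q T) :=
        mul_le_mul_of_nonneg_left (ENNReal.log_le_log hT)
          (EReal.coe_nonneg.2 (by positivity))

theorem mainTheorem2 {Ω : Type*} [MeasurableSpace Ω] (P : Measure Ω) [IsProbabilityMeasure P]
    (lam mu : ℝ) (hlam : 0 < lam) (hmu : 0 < mu) (α : ℝ≥0) (hα : 0 < α)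
    (η : ℕ → Ω → ℕ) (hη : IsCatastropheChain P lam mu η)
    (ν : ℝ≥0 → Ω → ℕ) (hν : IsPoissonProcess P α ν)
    (hην : IndepFun (fun ω k => η k ω) (fun ω t => ν t ω) P)
    (φ : ℝ≥0 → ℝ)
    (hφ_sublinear : Tendsto (fun T : ℝ≥0 => φ T / (T : ℝ)) atTop (𝓝 0))
    (hφ_power : ∃ a : ℝ, 0 < a ∧ a < 1 ∧
      Tendsto (fun T : ℝ≥0 => φ T / (T : ℝ) ^ a) atTop atTop) :
    SatisfiesLDP P (fun T => scaledProcess (catastropheProcess η ν) φ T 1) φ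
      (rateI₁ lam mu) := by
  obtain ⟨a, ha, -, hφa⟩ := hφ_power
  have hφ : Tendsto φ atTop atTop := tendsto_atTop_of_div_rpow ha hφa
  set l := Real.log ((lam + mu) / lam) with hl_def
  have hl : 0 < l := Real.log_pos ((one_lt_div hlam).2 (by linarith))
  have hp : lam / (lam + mu) = Real.exp (-l) := by
    rw [hl_def, ← Real.log_inv, inv_div, Real.exp_log (by positivity)]
  have hX : ∀ T ω, scaledProcess (catastropheProcess η ν) φ T 1 ω
      = catastropheProcess η ν T ω / φ T := fun T ω => by rw [scaledProcess, mul_one]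
  refine ⟨hφ, isCompact_rateI₁_le hl, fun B _ => ?_, fun B _ => ?_⟩
  · simp only [hX]
    by_contra! hlt
    obtain ⟨y, hy, hy'⟩ := exists_between hlt
    induction y with
    | bot => exact not_lt_bot hy
    | top => exact not_top_lt hy'
    | coe y =>
      refine hy'.not_ge ?_
      -- For `y ≥ 0` the bound by probability 1 suffices.
      rcases le_or_gt 0 y with hy0 | hy0
      · refine (limsup_log_le_of_eventually_le hφ (C := 1) (r := 0) one_pos ?_).trans ?_
        · refine Eventually.of_forall fun T => ?_
          simpa using prob_le_one
        · simpa using hy0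
      · obtain ⟨r, rfl⟩ : ∃ r, y = -r := ⟨-y, (neg_neg y).symm⟩
        have hr : 0 < r := by linarith
        have hrL : ENNReal.ofReal r < ⨅ x ∈ closure B, rateI₁ lam mu x := by
          rw [EReal.coe_neg, EReal.neg_lt_neg_iff] at hy
          rw [← EReal.coe_ennreal_lt_coe_ennreal_iff, EReal.coe_ennreal_ofReal, max_eq_left hr.le]
          exact hy
        -- The gap between `r` and `r'` pays for `z < 1 / p`: with `z = exp (r * l / r')`, the tail
        -- at level `r' / l * φ T` decays exactly like `exp (-(r * φ T))`, and the event lies in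
        -- that tail because the rate exceeds `r'` on `B ∩ [0, ∞)`.
        obtain ⟨r', -, hrr', hr'L⟩ := ENNReal.lt_iff_exists_real_btwn.1 hrL
        have hrr' : r < r' := (ENNReal.ofReal_lt_ofReal_iff_of_nonneg hr.le).1 hrr'
        have hr' : 0 < r' := hr.trans hrr'
        obtain ⟨C, hC, htail⟩ := exists_catastropheProcess_tail_le hη hν.measurable hην hlam hmu
          (z := Real.exp (r * l / r')) (Real.one_lt_exp_iff.2 (by positivity)) (by
            rw [hp, ← Real.exp_add, Real.exp_lt_one_iff]
            have : r * l / r' < l := by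
              rw [div_lt_iff₀ hr']
              nlinarith
            linarith)
        refine limsup_log_le_of_eventually_le hφ hC ?_
        filter_upwards [hφ.eventually_gt_atTop 0] with T hφT
        have hx : r * φ T = r' / l * φ T * Real.log (Real.exp (r * l / r')) := by
          rw [Real.log_exp]
          field_simp
        rw [hx]
        refine (measure_mono fun ω hω => ?_).trans (htail T _)
        have hω : (catastropheProcess η ν T ω : ℝ) / φ T ∈ B := hω
        have hx0 : 0 ≤ (catastropheProcess η ν T ω : ℝ) / φ T := by positivity
        have hI := hr'L.trans_le (iInf₂_le _ (subset_closure hω))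
        rw [rateI₁, if_neg hx0.not_gt] at hI
        have hI := (ENNReal.ofReal_lt_ofReal_iff_of_nonneg hr'.le).1 hI
        have hI := (div_lt_iff₀ hl).2 hI
        exact ((lt_div_iff₀ hφT).1 hI).le
  · simp only [hX]
    by_contra! hlt
    obtain ⟨y, hy, hy'⟩ := exists_between hlt
    induction y with
    | bot => exact not_lt_bot hy
    | top => exact not_top_lt hy'
    | coe y =>
      obtain ⟨r, rfl⟩ : ∃ r, y = -r := ⟨-y, (neg_neg y).symm⟩
      rw [EReal.coe_neg, EReal.neg_lt_neg_iff] at hy'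
      have hr : 0 < r := EReal.coe_pos.1 ((EReal.coe_ennreal_nonneg _).trans_lt hy')
      have hrL : ⨅ x ∈ interior B, rateI₁ lam mu x < ENNReal.ofReal r := by
        rw [← EReal.coe_ennreal_lt_coe_ennreal_iff, EReal.coe_ennreal_ofReal, max_eq_left hr.le]
        exact hy'
      obtain ⟨x, hrL⟩ := iInf_lt_iff.1 hrL
      obtain ⟨hxB, hxr⟩ := iInf_lt_iff.1 hrL
      have hx0 : 0 ≤ x := by
        by_contra! hneg
        rw [rateI₁, if_pos hneg] at hxr
        exact not_top_lt hxr
      rw [rateI₁, if_neg hx0.not_gt, ENNReal.ofReal_lt_ofReal_iff hr, ← hl_def] at hxr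
      obtain ⟨c, hc, hlow⟩ := exists_le_catastropheProcess_eq hη hν.measurable hην hlam hmu
      have hn : Tendsto (fun T => (⌈x * φ T⌉₊ : ℝ) / φ T) atTop (𝓝 x) :=
        (tendsto_nat_ceil_mul_div_atTop hx0).comp hφ
      -- Sublinearity of `φ` enters here: the jumps required are negligible against `T`.
      have hnT : Tendsto (fun T : ℝ≥0 => ((⌈x * φ T⌉₊ + 2 : ℕ) : ℝ) / T) atTop (𝓝 0) := by
        have h2 : Tendsto (fun T : ℝ≥0 => (2 : ℝ) / T) atTop (𝓝 0) :=
          (NNReal.tendsto_coe_atTop.2 tendsto_id).const_div_atTop 2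
        have h := (hn.mul hφ_sublinear).add h2
        rw [mul_zero, add_zero] at h
        refine h.congr' ?_
        filter_upwards [hφ.eventually_gt_atTop 0, eventually_gt_atTop 0] with T hφT hT
        have hT : (0 : ℝ) < T := hT
        push_cast
        field_simp
      refine hy.not_ge (le_trans ?_ (le_liminf_log_of_eventually_le hφ hc
        (p := lam / (lam + mu)) (by positivity) hn ?_))
      · rw [hp, Real.log_exp]
        exact EReal.coe_le_coe_iff.2 (by linarith)
      · filter_upwards [hν.eventually_lt_le_half hα hnT, hn (mem_interior_iff_mem_nhds.1 hxB)]
          with T hT hB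
        refine (hlow T _ hT).trans (measure_mono fun ω hω => ?_)
        have hω : catastropheProcess η ν T ω = ⌈x * φ T⌉₊ := hω
        rw [Set.mem_ofPred_eq, hω]
        exact hB
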